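/- An $n\times n$ linear space-time design in $K$ real variables $x_1,\dots,x_K$ is a matrix $\sum_{k=1}^{K}x_kA_k$ whose weight matrices $A_k\in\mathbb{C}^{n\times n}$ are linearly independent over $\mathbb{R}$; its rate is $\frac{K}{2n}$ complex symbols per channel use (cspcu). It is a unitary weight design (UWD) if every $A_k$ is unitary. It is $\lambda$-real-symbol (maximum-likelihood) decodable if the $K$ variables can be partitioned into $g$ groups of $\lambda$ variables each (so $K=g\lambda$), for some $g$, such that $A_k^{H}A_l+A_l^{H}A_k=0$ whenever $x_k$ and $x_l$ belong to different groups. Theorem. Let $a\ge 2$ be an integer. Every 4-real-symbol decodable $2^a\times 2^a$ unitary weight design has rate at most $\frac{a-1}{2^{a-2}}=\frac{4(a-1)}{2^a}$ cspcu. This bound is tight: for every $a\ge2$ there is a 4-real-symbol decodable $2^a\times 2^a$ unitary weight design whose rate equals $\frac{a-1}{2^{a-2}}$ cspcu. -/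

import Mathlib

open scoped Matrix

/-- An `n × n` linear space-time design `∑ k, x k • A k` in `K` real variables, given by its
weight matrices `A k`, which are linearly independent over `ℝ`. -/
structure LSTDesign (n K : ℕ) where
  /-- The weight matrices. -/
  weight : Fin K → Matrix (Fin n) (Fin n) ℂ
  /-- The weight matrices are linearly independent over the reals. -/
  linearIndependent : LinearIndependent ℝ weight

namespace LSTDesign

variable {n K : ℕ}

/-- The rate `K / (2 n)`, in complex symbols per channel use. -/
noncomputable def rate (_D : LSTDesign n K) : ℝ := (K : ℝ) / (2 * (n : ℝ))

/-- A unitary weight design: every weight matrix is unitary. -/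
def IsUnitaryWeight (D : LSTDesign n K) : Prop :=
  ∀ k, D.weight k ∈ Matrix.unitaryGroup (Fin n) ℂ

/-- The `K` real variables can be partitioned into `g` groups of exactly `lam` variables each
(`group k` is the group of the `k`-th variable; the partition is arbitrary), such that any two
weight matrices `A`, `B` of different groups satisfy `Aᴴ B + Bᴴ A = 0`. -/
def IsGroupDecodable (D : LSTDesign n K) (g lam : ℕ) : Prop :=
  ∃ group : Fin K → Fin g,
    (∀ i : Fin g, (Finset.univ.filter fun k => group k = i).card = lam) ∧
    ∀ k l : Fin K, group k ≠ group l →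
      (D.weight k)ᴴ * D.weight l + (D.weight l)ᴴ * D.weight k = 0

/-- `lam`-real-symbol (ML) decodable: `g`-group decodable with groups of `lam` real variables,
for some number of groups `g` (so that `K = g * lam`). -/
def IsRealSymbolDecodable (D : LSTDesign n K) (lam : ℕ) : Prop :=
  ∃ g : ℕ, D.IsGroupDecodable g lam

end LSTDesign

open Module

/-! Write `a = b + 2`; the bound says that there are at most `2 * b + 2` groups. Suppose there were
`2 * b + 3`. Left multiplication by the adjoint of one weight matrix puts `1` into one group and
makes every matrix of the other groups skew-Hermitian. One representative from each of these gives
an even Clifford family, whose commutant 𝒜 is a star-closed algebra of dimension at most 4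
(`two_pow_mul_finrank_commutant_le`) with scalar centre (`mem_span_one_of_mem_center`).

Take the group containing `1`, and another group divided by its representative. The two sets of
matrices commute. Their Hermitian parts lie in 𝒜, and their skew parts do after multiplication by a
suitable Clifford product. Since each group has four independent matrices, this yields pairs of
subspaces `P₁, Q₁` and `P₂, Q₂` of 𝒜, each pair of total dimension at least 4, which all commute
across the pairs except that `Q₁` and `Q₂` anticommute. Such an algebra has no room for them
(`false_of_commuting_subspaces`).

For tightness, a Hurwitz-Radon family of `2 * b + 2` unitaries of size `2 ^ b` is built by doubling;
four copies along the diagonal, with four independent sign patterns, turn each member into a group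
of four. -/

theorem eq_zero_of_eq_neg_self {E : Type*} [AddCommGroup E] [Module ℂ E] {x : E} (h : x = -x) :
    x = 0 := by
  have h2 : (2 : ℂ) • x = 0 := by
    rw [two_smul]; nth_rewrite 1 [h]; exact neg_add_cancel x
  exact (smul_eq_zero.1 h2).resolve_left two_ne_zero

theorem finrank_span_singleton_le_one {E : Type*} [AddCommGroup E] [Module ℂ E] (x : E) :
    finrank ℂ (ℂ ∙ x) ≤ 1 :=
  (finrank_span_le_card {x}).trans (by simp)

/-! ### Commuting subspaces of a small star algebra with scalar centre -/

section Core

variable {n : Type*} [Fintype n] [DecidableEq n]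

open scoped ComplexOrder in
/-- In a star-closed subspace of dimension at most four, the commutant of an element which is not
central has dimension at most two. -/
theorem finrank_commuting_le_two {𝒜 C : Submodule ℂ (Matrix n n ℂ)}
    (hmul : ∀ x ∈ 𝒜, ∀ y ∈ 𝒜, x * y ∈ 𝒜) (hstar : ∀ x ∈ 𝒜, xᴴ ∈ 𝒜)
    (hdim : finrank ℂ 𝒜 ≤ 4) {x z : Matrix n n ℂ} (hx : x ∈ 𝒜) (hz : z ∈ 𝒜)
    (hxz : x * z ≠ z * x) (hC : C ≤ 𝒜) (hCx : ∀ c ∈ C, x * c = c * x) :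
    finrank ℂ C ≤ 2 := by
  by_contra hlt
  push Not at hlt
  have hzC : z ∉ C := fun h => hxz (hCx z h)
  have hlt' : C < C ⊔ ℂ ∙ z := by
    refine lt_of_le_of_ne le_sup_left fun h => hzC ?_
    rw [h]
    exact Submodule.mem_sup_right (Submodule.mem_span_singleton_self z)
  have hle : C ⊔ ℂ ∙ z ≤ 𝒜 :=
    sup_le hC ((Submodule.span_singleton_le_iff_mem _ _).2 hz)
  have h1 := Submodule.finrank_lt_finrank_of_lt hlt'
  have heq : C ⊔ ℂ ∙ z = 𝒜 := Submodule.eq_of_le_of_finrank_le hle (by omega)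
  have hmem : (x * z - z * x)ᴴ ∈ 𝒜 :=
    hstar _ (𝒜.sub_mem (hmul _ hx _ hz) (hmul _ hz _ hx))
  rw [← heq, Submodule.mem_sup] at hmem
  obtain ⟨c, hc, y, hy, hcy⟩ := hmem
  obtain ⟨t, rfl⟩ := Submodule.mem_span_singleton.1 hy
  -- The commutator of `x` and `z` is trace-orthogonal to `z` and to everything commuting with `x`,
  -- hence to all of 𝒜, which contains its own adjoint.
  have htr : ((x * z - z * x) * (x * z - z * x)ᴴ).trace = 0 := by
    rw [← hcy, mul_add, Matrix.trace_add, Matrix.mul_smul, Matrix.trace_smul, sub_mul, sub_mul,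
      Matrix.trace_sub, Matrix.trace_sub]
    have e1 : (z * x * c).trace = (x * z * c).trace := by
      rw [mul_assoc, hCx c hc, ← mul_assoc, Matrix.trace_mul_comm, ← mul_assoc]
    have e2 : (z * x * z).trace = (x * z * z).trace := by
      rw [mul_assoc, Matrix.trace_mul_comm]
    rw [e1, e2]; simp
  rw [Matrix.trace_mul_conjTranspose_self_eq_zero_iff] at htr
  exact hxz (sub_eq_zero.1 htr)

/-- A nonscalar `x` in `P₁` has a commutant of dimension at most 2, containing `P₂`, `Q₂` and `1`.
The dimension count forces `1 ∈ Q₂`, so `Q₁`, anticommuting with `1`, vanishes. Then `P₁` is all of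
𝒜 and `P₂` is central, too small for the second count. -/
theorem le_span_one_of_commuting_subspaces {𝒜 P₁ Q₁ P₂ Q₂ : Submodule ℂ (Matrix n n ℂ)}
    (hone : 1 ∈ 𝒜) (hmul : ∀ x ∈ 𝒜, ∀ y ∈ 𝒜, x * y ∈ 𝒜) (hstar : ∀ x ∈ 𝒜, xᴴ ∈ 𝒜)
    (hdim : finrank ℂ 𝒜 ≤ 4)
    (hcenter : ∀ x ∈ 𝒜, (∀ y ∈ 𝒜, x * y = y * x) → x ∈ ℂ ∙ (1 : Matrix n n ℂ))
    (hP₁ : P₁ ≤ 𝒜) (hP₂ : P₂ ≤ 𝒜) (hQ₂ : Q₂ ≤ 𝒜)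
    (hPP : ∀ x ∈ P₁, ∀ y ∈ P₂, x * y = y * x) (hPQ : ∀ x ∈ P₁, ∀ y ∈ Q₂, x * y = y * x)
    (hQQ : ∀ x ∈ Q₁, ∀ y ∈ Q₂, x * y = -(y * x))
    (h₁ : 4 ≤ finrank ℂ P₁ + finrank ℂ Q₁) (h₂ : 4 ≤ finrank ℂ P₂ + finrank ℂ Q₂) :
    P₁ ≤ ℂ ∙ (1 : Matrix n n ℂ) := by
  intro x hx
  by_contra hxs
  obtain ⟨z, hz, hxz⟩ : ∃ z ∈ 𝒜, x * z ≠ z * x := by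
    by_contra! h
    exact hxs (hcenter x (hP₁ hx) h)
  have hP2 := finrank_commuting_le_two hmul hstar hdim (hP₁ hx) hz hxz hP₂ (hPP x hx)
  have hQ2 : finrank ℂ ↥(Q₂ ⊔ ℂ ∙ (1 : Matrix n n ℂ)) ≤ 2 := by
    refine finrank_commuting_le_two hmul hstar hdim (hP₁ hx) hz hxz
      (sup_le hQ₂ ((Submodule.span_singleton_le_iff_mem _ _).2 hone)) fun c hc => ?_
    obtain ⟨q, hq, y, hy, rfl⟩ := Submodule.mem_sup.1 hc
    obtain ⟨t, rfl⟩ := Submodule.mem_span_singleton.1 hy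
    rw [mul_add, add_mul, hPQ x hx q hq]; simp
  have heq : Q₂ = Q₂ ⊔ ℂ ∙ (1 : Matrix n n ℂ) :=
    Submodule.eq_of_le_of_finrank_le le_sup_left (by omega)
  have h1Q : (1 : Matrix n n ℂ) ∈ Q₂ := by
    rw [heq]; exact Submodule.mem_sup_right (Submodule.mem_span_singleton_self _)
  have hQ1 : Q₁ = ⊥ := by
    rw [Submodule.eq_bot_iff]
    intro q hq
    have := hQQ q hq 1 h1Q
    rw [mul_one, one_mul] at this
    exact eq_zero_of_eq_neg_self this
  have hPA : P₁ = 𝒜 := by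
    refine Submodule.eq_of_le_of_finrank_le hP₁ ?_
    rw [hQ1, finrank_bot] at h₁
    omega
  have hPs : P₂ ≤ ℂ ∙ (1 : Matrix n n ℂ) := fun y hy =>
    hcenter y (hP₂ hy) fun w hw => (hPP w (hPA ▸ hw) y hy).symm
  have := (Submodule.finrank_mono hPs).trans (finrank_span_singleton_le_one _)
  have := Submodule.finrank_mono (le_sup_left : Q₂ ≤ Q₂ ⊔ ℂ ∙ (1 : Matrix n n ℂ))
  omega

open scoped ComplexOrder in
-- With `P₁` and `P₂` scalar, `Q₁` and `Q₂` have dimension at least 3 inside dimension 4, so they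
-- meet. But a common `q` anticommutes with its adjoint, so the trace of `q * qᴴ` is zero.
theorem false_of_commuting_subspaces {𝒜 P₁ Q₁ P₂ Q₂ : Submodule ℂ (Matrix n n ℂ)}
    (hone : 1 ∈ 𝒜) (hmul : ∀ x ∈ 𝒜, ∀ y ∈ 𝒜, x * y ∈ 𝒜) (hstar : ∀ x ∈ 𝒜, xᴴ ∈ 𝒜)
    (hdim : finrank ℂ 𝒜 ≤ 4)
    (hcenter : ∀ x ∈ 𝒜, (∀ y ∈ 𝒜, x * y = y * x) → x ∈ ℂ ∙ (1 : Matrix n n ℂ))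
    (hP₁ : P₁ ≤ 𝒜) (hQ₁ : Q₁ ≤ 𝒜) (hP₂ : P₂ ≤ 𝒜) (hQ₂ : Q₂ ≤ 𝒜)
    (hPP : ∀ x ∈ P₁, ∀ y ∈ P₂, x * y = y * x) (hPQ : ∀ x ∈ P₁, ∀ y ∈ Q₂, x * y = y * x)
    (hQP : ∀ x ∈ Q₁, ∀ y ∈ P₂, x * y = y * x)
    (hQQ : ∀ x ∈ Q₁, ∀ y ∈ Q₂, x * y = -(y * x)) (hQstar : ∀ x ∈ Q₂, xᴴ ∈ Q₂)
    (h₁ : 4 ≤ finrank ℂ P₁ + finrank ℂ Q₁) (h₂ : 4 ≤ finrank ℂ P₂ + finrank ℂ Q₂) :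
    False := by
  have hs₁ := le_span_one_of_commuting_subspaces hone hmul hstar hdim hcenter hP₁ hP₂ hQ₂
    hPP hPQ hQQ h₁ h₂
  have hs₂ := le_span_one_of_commuting_subspaces hone hmul hstar hdim hcenter hP₂ hP₁ hQ₁
    (fun x hx y hy => (hPP y hy x hx).symm) (fun x hx y hy => (hQP y hy x hx).symm)
    (fun x hx y hy => by rw [hQQ y hy x hx, neg_neg]) h₂ h₁
  have hd₁ := (Submodule.finrank_mono hs₁).trans (finrank_span_singleton_le_one _)
  have hd₂ := (Submodule.finrank_mono hs₂).trans (finrank_span_singleton_le_one _)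
  have hsup := (Submodule.finrank_mono (sup_le hQ₁ hQ₂)).trans hdim
  have hadd := Submodule.finrank_sup_add_finrank_inf_eq Q₁ Q₂
  have hinf : Q₁ ⊓ Q₂ = ⊥ := by
    rw [Submodule.eq_bot_iff]
    rintro q ⟨hq₁, hq₂⟩
    have h := congrArg Matrix.trace (hQQ q hq₁ qᴴ (hQstar q hq₂))
    rw [Matrix.trace_neg, Matrix.trace_mul_comm qᴴ q] at h
    exact Matrix.trace_mul_conjTranspose_self_eq_zero_iff.1 (eq_zero_of_eq_neg_self h)
  rw [hinf, finrank_bot] at hadd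
  omega

end Core

/-! ### Clifford families and their commutants -/

/-- A family of pairwise anticommuting skew-Hermitian matrices of square `-1`. -/
structure IsCliffordFamily {n κ : Type*} [Fintype n] [DecidableEq n]
    (A : κ → Matrix n n ℂ) : Prop where
  sq : ∀ i, A i * A i = -1
  star : ∀ i, (A i)ᴴ = -A i
  anticomm : ∀ i j, i ≠ j → A i * A j = -(A j * A i)

/-- The matrices commuting with `A i` for all `i ∈ s`. -/
def commutant {n κ : Type*} [Fintype n] [DecidableEq n] (A : κ → Matrix n n ℂ) (s : Finset κ) :
    Submodule ℂ (Matrix n n ℂ) where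
  carrier := {X | ∀ i ∈ s, X * A i = A i * X}
  add_mem' hX hY i hi := by rw [add_mul, mul_add, hX i hi, hY i hi]
  zero_mem' i _ := by simp
  smul_mem' c X hX i hi := by rw [Matrix.smul_mul, Matrix.mul_smul, hX i hi]

theorem mul_list_prod_of_sign {R κ : Type*} [Ring R] {A : κ → R} {X : R} (s : κ → ℤ)
    (h : ∀ i, X * A i = s i • (A i * X)) (l : List κ) :
    X * (l.map A).prod = (l.map s).prod • ((l.map A).prod * X) := by
  induction l with
  | nil => simp
  | cons i l ih =>
    simp only [List.map_cons, List.prod_cons]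
    rw [← mul_assoc, h, smul_mul_assoc, mul_assoc (A i), ih, mul_smul_comm, smul_smul, mul_assoc]

namespace IsCliffordFamily

variable {n κ : Type*} [Fintype n] [DecidableEq n] {A : κ → Matrix n n ℂ}

theorem isUnit (hA : IsCliffordFamily A) (i : κ) : IsUnit (A i) :=
  .of_mul_eq_one (-A i) (by rw [mul_neg, hA.sq, neg_neg])

theorem isUnit_list_prod (hA : IsCliffordFamily A) (l : List κ) : IsUnit (l.map A).prod := by
  induction l with
  | nil => simp
  | cons i l ih => rw [List.map_cons, List.prod_cons]; exact (hA.isUnit i).mul ih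

theorem mul_list_prod [DecidableEq κ] (hA : IsCliffordFamily A) (i : κ) (l : List κ) :
    A i * (l.map A).prod =
      (l.map fun j => if j = i then (1 : ℤ) else -1).prod • ((l.map A).prod * A i) := by
  refine mul_list_prod_of_sign _ (fun j => ?_) l
  split_ifs with h
  · subst h; simp
  · rw [hA.anticomm i j (Ne.symm h)]; simp

theorem list_prod_conjTranspose (hA : IsCliffordFamily A) (l : List κ) :
    (l.map A).prodᴴ = (l.map A).prod ∨ (l.map A).prodᴴ = -(l.map A).prod := by
  classical
  induction l with
  | nil => simp
  | cons i l ih =>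
    have hs : ∀ l : List κ, (l.map fun j => if j = i then (1 : ℤ) else -1).prod = 1 ∨
        (l.map fun j => if j = i then (1 : ℤ) else -1).prod = -1 := by
      intro l
      induction l with
      | nil => simp
      | cons j l ih =>
        rw [List.map_cons, List.prod_cons]
        split_ifs <;> rcases ih with h | h <;> simp [h]
    have hm := hA.mul_list_prod i l
    rw [List.map_cons, List.prod_cons, Matrix.conjTranspose_mul, hA.star]
    rcases hs l with h | h <;> rw [h] at hm <;> rcases ih with h' | h' <;> rw [h', hm] <;> simp

section Even

variable [Fintype κ]

/-- The product of all members of the family, in some order. -/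
noncomputable def volume (A : κ → Matrix n n ℂ) : Matrix n n ℂ :=
  ((Finset.univ : Finset κ).toList.map A).prod

theorem mul_volume_of_sign {X : Matrix n n ℂ} (s : κ → ℤ)
    (h : ∀ i, X * A i = s i • (A i * X)) : X * volume A = (∏ i, s i) • (volume A * X) := by
  rw [volume, mul_list_prod_of_sign s h, Finset.prod_map_toList]

/-- `A i` passes itself freely and picks up a sign from each of the other members, which are odd in
number. -/
theorem volume_mul [DecidableEq κ] (hA : IsCliffordFamily A) (hκ : Even (Fintype.card κ)) (i : κ) :
    volume A * A i = -(A i * volume A) := by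
  have h := mul_volume_of_sign (A := A) (X := A i) (fun j => if j = i then 1 else -1) fun j => by
    split_ifs with h
    · subst h; simp
    · rw [hA.anticomm i j (Ne.symm h)]; simp
  have hpos : 0 < Fintype.card κ := Fintype.card_pos_iff.2 ⟨i⟩
  have hs : (∏ j, if j = i then (1 : ℤ) else -1) = -1 := by
    rw [← Finset.mul_prod_erase _ _ (Finset.mem_univ i)]
    rw [Finset.prod_congr rfl (g := fun _ => (-1 : ℤ))
      (fun j hj => if_neg (Finset.ne_of_mem_erase hj))]
    rw [Finset.prod_const, Finset.card_erase_of_mem (Finset.mem_univ i), Finset.card_univ]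
    simp only [if_true, one_mul]
    exact Odd.neg_one_pow (Nat.Even.sub_odd hpos hκ odd_one)
  rw [hs] at h
  rw [h]; simp

theorem volume_isUnit (hA : IsCliffordFamily A) : IsUnit (volume A) := hA.isUnit_list_prod _

/-- `volume A * A i` anticommutes with `A i` and commutes with the other members. -/
theorem flip_mul_of_ne [DecidableEq κ] (hA : IsCliffordFamily A) (hκ : Even (Fintype.card κ)) {i j : κ}
    (hij : j ≠ i) : volume A * A i * A j = A j * (volume A * A i) := by
  rw [mul_assoc, hA.anticomm i j hij.symm, mul_neg, ← mul_assoc, hA.volume_mul hκ, neg_mul,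
    neg_neg, mul_assoc]

theorem flip_mul_self [DecidableEq κ] (hA : IsCliffordFamily A) (hκ : Even (Fintype.card κ)) (i : κ) :
    volume A * A i * A i = -(A i * (volume A * A i)) := by
  rw [← mul_assoc (A i), hA.volume_mul hκ]
  simp [mul_assoc, hA.volume_mul hκ]

theorem commute_volume {X : Matrix n n ℂ} (h : ∀ i, X * A i = A i * X) :
    X * volume A = volume A * X := by
  simpa using mul_volume_of_sign (A := A) (X := X) (fun _ => 1) (by simpa using h)

variable [DecidableEq κ]

/-- `F = volume A * A i` commutes with `A j` for `j ∈ s` but anticommutes with `A i`. Two copies of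
the smaller commutant therefore embed by `(y, z) ↦ y + F * z`: the two terms are separated by their
sign against `A i`. -/
theorem two_mul_finrank_commutant_insert_le (hA : IsCliffordFamily A)
    (hκ : Even (Fintype.card κ)) {i : κ} {s : Finset κ} (hi : i ∉ s) :
    2 * finrank ℂ (commutant A (insert i s)) ≤ finrank ℂ (commutant A s) := by
  set F := volume A * A i with hF
  have hFu : IsUnit F := hA.volume_isUnit.mul (hA.isUnit i)
  have hFs : ∀ j ∈ s, F * A j = A j * F := fun j hj =>
    hA.flip_mul_of_ne hκ (by rintro rfl; exact hi hj)
  have hFi := hA.flip_mul_self hκ i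
  rw [← hF] at hFi
  let f : (commutant A (insert i s) × commutant A (insert i s)) →ₗ[ℂ] commutant A s :=
    { toFun := fun p => ⟨p.1 + F * p.2, fun j hj => by
        have h1 := p.1.2 j (Finset.mem_insert_of_mem hj)
        have h2 := p.2.2 j (Finset.mem_insert_of_mem hj)
        rw [add_mul, mul_add, h1, mul_assoc, h2, ← mul_assoc, hFs j hj, mul_assoc]⟩
      map_add' := fun p q => by
        ext1; simp [mul_add]; abel
      map_smul' := fun c p => by
        ext1; simp }
  have hf : Function.Injective f := by
    rw [← LinearMap.ker_eq_bot, LinearMap.ker_eq_bot']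
    rintro ⟨⟨y, hy⟩, ⟨z, hz⟩⟩ h
    have h0 : y + F * z = 0 := congrArg Subtype.val h
    have hyi := hy i (Finset.mem_insert_self i s)
    have hzi := hz i (Finset.mem_insert_self i s)
    have h1 : A i * (y - F * z) = 0 := by
      have : (y + F * z) * A i = A i * (y - F * z) := by
        rw [add_mul, mul_assoc, hzi, ← mul_assoc, hFi, hyi, mul_sub]
        simp [sub_eq_add_neg, mul_assoc]
      rw [← this, h0, zero_mul]
    have h2 : y - F * z = 0 := by
      rwa [(hA.isUnit i).mul_right_eq_zero] at h1
    have hy0 : y = 0 := by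
      have : (2 : ℂ) • y = 0 := by
        rw [two_smul]
        calc y + y = (y + F * z) + (y - F * z) := by abel
          _ = 0 := by rw [h0, h2, add_zero]
      simpa using this
    have hz0 : z = 0 := by
      rw [hy0, zero_add] at h0
      rwa [hFu.mul_right_eq_zero] at h0
    subst hy0 hz0
    rfl
  have := LinearMap.finrank_le_finrank_of_injective hf
  rw [finrank_prod] at this
  omega

theorem two_pow_mul_finrank_commutant_le (hA : IsCliffordFamily A)
    (hκ : Even (Fintype.card κ)) (s : Finset κ) :
    2 ^ s.card * finrank ℂ (commutant A s) ≤ Fintype.card n * Fintype.card n := by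
  induction s using Finset.induction_on with
  | empty =>
    refine (Nat.le_of_eq (by simp)).trans ((Submodule.finrank_le (commutant A ∅)).trans
      (Nat.le_of_eq ?_))
    rw [finrank_matrix]; simp
  | insert i s hi ih =>
    rw [Finset.card_insert_of_notMem hi, pow_succ, mul_assoc]
    exact (Nat.mul_le_mul_left _ (hA.two_mul_finrank_commutant_insert_le hκ hi)).trans ih

/-- Dropping the constraints one at a time shows that `x` commutes with every matrix. When `A i` is
dropped, `y` splits into a part commuting with `A i` and a part anticommuting with it; the latter is
returned to the previous commutant by `F`, with which `x` commutes. -/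
theorem mem_span_one_of_mem_center (hA : IsCliffordFamily A) (hκ : Even (Fintype.card κ))
    {x : Matrix n n ℂ} (hx : x ∈ commutant A Finset.univ)
    (hxc : ∀ y ∈ commutant A Finset.univ, x * y = y * x) :
    x ∈ ℂ ∙ (1 : Matrix n n ℂ) := by
  have hxA : ∀ i, x * A i = A i * x := fun i => hx i (Finset.mem_univ i)
  have key : ∀ s : Finset κ, ∀ y ∈ commutant A sᶜ, x * y = y * x := by
    intro s
    induction s using Finset.induction_on with
    | empty => simpa using hxc
    | insert i s hi ih =>
      intro y hy
      set F := volume A * A i with hF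
      have hFu : IsUnit F := hA.volume_isUnit.mul (hA.isUnit i)
      have hxF : x * F = F * x := by
        rw [hF, ← mul_assoc, commute_volume hxA, mul_assoc, hxA, mul_assoc]
      have hyj : ∀ j ∈ sᶜ, j ≠ i → y * A j = A j * y := fun j hj hji =>
        hy j (by simp only [Finset.mem_compl, Finset.mem_insert, not_or] at hj ⊢; exact ⟨hji, hj⟩)
      have hAi := hA.sq i
      have hAA : A i * (A i * y * A i) = -(y * A i) := by
        rw [mul_assoc (A i) y, ← mul_assoc (A i) (A i), hAi, neg_mul, one_mul]
      have h1 : x * (y - A i * y * A i) = (y - A i * y * A i) * x := by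
        refine ih _ fun j hj => ?_
        by_cases hji : j = i
        · subst hji
          rw [sub_mul, mul_sub, mul_assoc (A j * y), hAi, hAA]
          simp [add_comm]
        · have e := hyj j hj hji
          have ea := hA.anticomm i j (Ne.symm hji)
          rw [sub_mul, mul_sub, e, mul_assoc (A i * y), ea, mul_neg, ← mul_assoc, mul_assoc (A i), e,
            ← mul_assoc, ea]
          simp [mul_assoc]
      have h2 : x * (F * (y + A i * y * A i)) = F * (y + A i * y * A i) * x := by
        refine ih _ fun j hj => ?_
        by_cases hji : j = i
        · subst hji
          have hFi := hA.flip_mul_self hκ j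
          rw [← hF] at hFi
          have : (y + A j * y * A j) * A j = -(A j * (y + A j * y * A j)) := by
            rw [add_mul, mul_add, mul_assoc (A j * y), hAi, hAA]
            simp
          rw [mul_assoc, this, mul_neg, ← mul_assoc, hFi, neg_mul, neg_neg, mul_assoc]
        · have e := hyj j hj hji
          have ea := hA.anticomm i j (Ne.symm hji)
          have hFj := hA.flip_mul_of_ne hκ hji
          rw [← hF] at hFj
          have : (y + A i * y * A i) * A j = A j * (y + A i * y * A i) := by
            rw [add_mul, mul_add, e, mul_assoc (A i * y), ea, mul_neg, ← mul_assoc,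
              mul_assoc (A i), e, ← mul_assoc, ea]
            simp [mul_assoc]
          rw [mul_assoc, this, ← mul_assoc, hFj, mul_assoc]
      have h3 : x * (y + A i * y * A i) = (y + A i * y * A i) * x := by
        rw [← mul_assoc, hxF, mul_assoc, mul_assoc F] at h2
        exact hFu.mul_left_cancel h2
      have h4 : (2 : ℂ) • (x * y) = (2 : ℂ) • (y * x) := by
        calc (2 : ℂ) • (x * y) = x * (y - A i * y * A i) + x * (y + A i * y * A i) := by
              rw [two_smul]; noncomm_ring
          _ = (2 : ℂ) • (y * x) := by rw [h1, h3, two_smul]; noncomm_ring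
      exact smul_right_injective _ (two_ne_zero' ℂ) h4
  have hall : ∀ y, x * y = y * x := fun y => key Finset.univ y (by intro i hi; simp at hi)
  have hmem : x ∈ Subalgebra.center ℂ (Matrix n n ℂ) :=
    Subalgebra.mem_center_iff.2 fun y => (hall y).symm
  rw [Algebra.IsCentral.center_eq_bot, Algebra.mem_bot] at hmem
  obtain ⟨c, rfl⟩ := hmem
  exact Submodule.mem_span_singleton.2 ⟨c, (Algebra.algebraMap_eq_smul_one c).symm⟩

end Even

end IsCliffordFamily

/-! ### The upper bound: two groups against a Clifford family -/

theorem span_conjTranspose_mem {n : Type*} {S : Set (Matrix n n ℂ)}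
    (hS : ∀ x ∈ S, xᴴ ∈ Submodule.span ℂ S) :
    ∀ x ∈ Submodule.span ℂ S, xᴴ ∈ Submodule.span ℂ S := by
  intro x hx
  induction hx using Submodule.span_induction with
  | mem x hx => exact hS x hx
  | zero => simp
  | add x y _ _ hx hy => rw [Matrix.conjTranspose_add]; exact add_mem hx hy
  | smul c x _ hx => rw [Matrix.conjTranspose_smul]; exact Submodule.smul_mem _ _ hx

section Pair

variable {n κ : Type*} [Fintype n] [DecidableEq n]

/-- The relation `Dᴴ * B = B * D` cuts out a real subspace meeting its multiple by `I` only in zero,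
so the real and imaginary parts of a complex relation vanish separately. -/
theorem linearIndependent_complex_of_conjTranspose_mul {ι : Type*}
    {D : ι → Matrix n n ℂ} {B : Matrix n n ℂ} (hB : IsUnit B)
    (hD : ∀ k, (D k)ᴴ * B = B * D k) (hli : LinearIndependent ℝ D) : LinearIndependent ℂ D := by
  rw [linearIndependent_iff'] at hli ⊢
  intro s c hc k hk
  have hreal : ∀ p : ι → ℝ, (∑ i ∈ s, p i • D i)ᴴ * B = B * ∑ i ∈ s, p i • D i := by
    intro p
    rw [Matrix.conjTranspose_sum, Finset.sum_mul, Finset.mul_sum]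
    refine Finset.sum_congr rfl fun i _ => ?_
    rw [Matrix.conjTranspose_smul, star_trivial, Matrix.smul_mul, hD, Matrix.mul_smul]
  set E := ∑ i ∈ s, (c i).re • D i with hE
  set E' := ∑ i ∈ s, (c i).im • D i with hE'
  have hsum : E + Complex.I • E' = 0 := by
    rw [← hc, hE, hE', Finset.smul_sum, ← Finset.sum_add_distrib]
    refine Finset.sum_congr rfl fun i _ => ?_
    conv_rhs => rw [← Complex.re_add_im (c i), add_smul, mul_comm, mul_smul]
    simp only [Complex.coe_smul]
  have h1 := hreal fun i => (c i).re
  have h2 := hreal fun i => (c i).im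
  rw [← hE] at h1
  rw [← hE'] at h2
  have hEe : E = -(Complex.I • E') := eq_neg_of_add_eq_zero_left hsum
  have h3 : Complex.I • (B * E') = -(Complex.I • (B * E')) := by
    rw [hEe] at h1
    simpa [h2] using h1
  have h4 := eq_zero_of_eq_neg_self h3
  rw [smul_eq_zero, hB.mul_right_eq_zero] at h4
  have h5 : E' = 0 := h4.resolve_left Complex.I_ne_zero
  have h6 : E = 0 := by rw [hEe, h5]; simp
  exact Complex.ext (hli s _ h6 k hk) (hli s _ h5 k hk)

theorem card_le_finrank_span_add {ι : Type*} [Fintype ι] {D : ι → Matrix n n ℂ}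
    {F : Matrix n n ℂ} (hF : IsUnit F) (hli : LinearIndependent ℂ D) :
    Fintype.card ι ≤ finrank ℂ (Submodule.span ℂ (Set.range fun k => D k + (D k)ᴴ)) +
      finrank ℂ (Submodule.span ℂ (Set.range fun k => (D k - (D k)ᴴ) * F)) := by
  set P := Submodule.span ℂ (Set.range fun k => D k + (D k)ᴴ)
  set Q := Submodule.span ℂ (Set.range fun k => (D k - (D k)ᴴ) * F)
  obtain ⟨G, hFG, -⟩ := isUnit_iff_exists.1 hF
  have hle : Submodule.span ℂ (Set.range D) ≤ P ⊔ Q.map (LinearMap.mulRight ℂ G) := by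
    rw [Submodule.span_le]
    rintro _ ⟨k, rfl⟩
    have hP : D k + (D k)ᴴ ∈ P := Submodule.subset_span ⟨k, rfl⟩
    have hQ : D k - (D k)ᴴ ∈ Q.map (LinearMap.mulRight ℂ G) :=
      ⟨_, Submodule.subset_span ⟨k, rfl⟩, by simp [mul_assoc, hFG]⟩
    have := Submodule.smul_mem _ (2⁻¹ : ℂ) (Submodule.add_mem_sup hP hQ)
    have e : (2⁻¹ : ℂ) • (D k + (D k)ᴴ + (D k - (D k)ᴴ)) = D k := by
      rw [add_add_sub_cancel, ← two_smul ℂ, smul_smul]; simp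
    rwa [e] at this
  rw [← finrank_span_eq_card hli]
  refine (Submodule.finrank_mono hle).trans ((Submodule.finrank_add_le_finrank_add_finrank _ _).trans
    (Nat.add_le_add_left (Submodule.finrank_map_le _ _) _))

theorem span_mul_eq_smul_mul (ε : ℂ) {S T : Set (Matrix n n ℂ)}
    (h : ∀ x ∈ S, ∀ y ∈ T, x * y = ε • (y * x)) :
    ∀ x ∈ Submodule.span ℂ S, ∀ y ∈ Submodule.span ℂ T, x * y = ε • (y * x) := by
  intro x hx y hy
  induction hx, hy using Submodule.span_induction₂ with
  | mem_mem x y hx hy => exact h x hx y hy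
  | zero_left y hy => simp
  | zero_right x hx => simp
  | add_left x y z hx hy hz h₁ h₂ => rw [add_mul, mul_add, h₁, h₂, smul_add]
  | add_right x y z hx hy hz h₁ h₂ => rw [add_mul, mul_add, h₁, h₂, smul_add]
  | smul_left r x y hx hy h => rw [smul_mul_assoc, mul_smul_comm, h, smul_comm]
  | smul_right r x y hx hy h => rw [smul_mul_assoc, mul_smul_comm, h, smul_comm]

namespace IsCliffordFamily

variable [Fintype κ] {A : κ → Matrix n n ℂ}

/-- The skew part of `D₁ k` anticommutes with every `A l`, that of `D₂ k` with `A i` alone. Right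
multiplication by `W = volume A`, respectively by `F = W * A i`, corrects exactly these signs and
lands in the commutant. -/
theorem not_linearIndependent_pair [DecidableEq κ] (hA : IsCliffordFamily A)
    (hκ : Even (Fintype.card κ))
    (hcard : Fintype.card n * Fintype.card n = 2 ^ Fintype.card κ * 4) {i j : κ} (hij : j ≠ i)
    {D₁ D₂ : Fin 4 → Matrix n n ℂ} (hli₁ : LinearIndependent ℝ D₁)
    (hli₂ : LinearIndependent ℝ D₂) (h₁ : ∀ k l, (D₁ k)ᴴ * A l = A l * D₁ k)
    (h₂ : ∀ k, (D₂ k)ᴴ * A i = A i * D₂ k) (h₂' : ∀ k l, l ≠ i → D₂ k * A l = A l * D₂ k)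
    (hcomm : ∀ k l, D₁ k * D₂ l = D₂ l * D₁ k) : False := by
  have conj_swap : ∀ (D : Matrix n n ℂ) l, Dᴴ * A l = A l * D → D * A l = A l * Dᴴ := by
    intro D l h
    have e : A l * (Dᴴ * A l) * A l = A l * (A l * D) * A l := by rw [h]
    rw [← mul_assoc, ← mul_assoc, mul_assoc (A l * Dᴴ), hA.sq] at e
    simpa using e.symm
  have h₁s : ∀ k l, D₁ k * A l = A l * (D₁ k)ᴴ := fun k l => conj_swap _ _ (h₁ k l)
  have h₂s : ∀ k, D₂ k * A i = A i * (D₂ k)ᴴ := fun k => conj_swap _ _ (h₂ k)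
  have h₂s' : ∀ k l, l ≠ i → (D₂ k)ᴴ * A l = A l * (D₂ k)ᴴ := by
    intro k l hl
    have := congrArg Matrix.conjTranspose (h₂' k l hl)
    rw [Matrix.conjTranspose_mul, Matrix.conjTranspose_mul, hA.star] at this
    simpa using this.symm
  -- A second index `j ≠ i` is needed: `A j` conjugates `D₁ k` into its adjoint while fixing `D₂ l`.
  have hc₁ : ∀ k l, (D₁ k)ᴴ * D₂ l = D₂ l * (D₁ k)ᴴ := by
    intro k l
    refine (hA.isUnit j).mul_left_cancel ?_
    rw [← mul_assoc, ← h₁s, mul_assoc, ← h₂' l j hij, ← mul_assoc, hcomm, mul_assoc, h₁s,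
      ← mul_assoc, h₂' l j hij, mul_assoc]
  have hc₂ : ∀ k l, D₁ k * (D₂ l)ᴴ = (D₂ l)ᴴ * D₁ k := by
    intro k l
    simpa using (congrArg Matrix.conjTranspose (hc₁ k l)).symm
  have hc₃ : ∀ k l, (D₁ k)ᴴ * (D₂ l)ᴴ = (D₂ l)ᴴ * (D₁ k)ᴴ := by
    intro k l
    simpa using (congrArg Matrix.conjTranspose (hcomm k l)).symm
  set W := volume A with hW
  have hWu : IsUnit W := hA.volume_isUnit
  have hWA : ∀ l, W * A l = -(A l * W) := hA.volume_mul hκ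
  set F := W * A i with hF
  have hFu : IsUnit F := hWu.mul (hA.isUnit i)
  have hFW : F * W = -(W * F) := by rw [hF, mul_assoc, ← neg_eq_iff_eq_neg.2 (hWA i), mul_neg]
  have hFl : ∀ l, l ≠ i → F * A l = A l * F := fun l hl => hA.flip_mul_of_ne hκ hl
  have hFi : F * A i = -(A i * F) := hA.flip_mul_self hκ i
  set 𝒜 := commutant A Finset.univ with h𝒜
  have mem𝒜 : ∀ X, (∀ l, X * A l = A l * X) → X ∈ 𝒜 := fun X hX l _ => hX l
  have mem𝒜' : ∀ X ∈ 𝒜, ∀ l, X * A l = A l * X := fun X hX l => hX l (Finset.mem_univ l)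
  have h𝒜W : ∀ X ∈ 𝒜, X * W = W * X := fun X hX => commute_volume (mem𝒜' X hX)
  have h𝒜F : ∀ X ∈ 𝒜, X * F = F * X := fun X hX => by
    rw [hF, ← mul_assoc, h𝒜W X hX, mul_assoc, mem𝒜' X hX, mul_assoc]
  have hH₁ : ∀ k, D₁ k + (D₁ k)ᴴ ∈ 𝒜 := fun k => mem𝒜 _ fun l => by
    rw [add_mul, mul_add, h₁, h₁s, add_comm]
  have hH₂ : ∀ k, D₂ k + (D₂ k)ᴴ ∈ 𝒜 := fun k => mem𝒜 _ fun l => by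
    by_cases hl : l = i
    · subst hl; rw [add_mul, mul_add, h₂, h₂s, add_comm]
    · rw [add_mul, mul_add, h₂' _ _ hl, h₂s' _ _ hl]
  have hT₁ : ∀ k l, (D₁ k - (D₁ k)ᴴ) * A l = -(A l * (D₁ k - (D₁ k)ᴴ)) := fun k l => by
    rw [sub_mul, mul_sub, h₁, h₁s, neg_sub]
  have hT₂ : ∀ k, (D₂ k - (D₂ k)ᴴ) * A i = -(A i * (D₂ k - (D₂ k)ᴴ)) := fun k => by
    rw [sub_mul, mul_sub, h₂, h₂s, neg_sub]
  have hT₂' : ∀ k l, l ≠ i → (D₂ k - (D₂ k)ᴴ) * A l = A l * (D₂ k - (D₂ k)ᴴ) :=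
    fun k l hl => by rw [sub_mul, mul_sub, h₂' _ _ hl, h₂s' _ _ hl]
  have hT₁W : ∀ k, (D₁ k - (D₁ k)ᴴ) * W = W * (D₁ k - (D₁ k)ᴴ) := fun k => by
    have := mul_volume_of_sign (A := A) (X := D₁ k - (D₁ k)ᴴ) (fun _ => -1) fun l => by
      rw [hT₁]; simp
    rw [this, Finset.prod_const, Finset.card_univ, hκ.neg_one_pow, one_smul]
  have hT₂W : ∀ k, (D₂ k - (D₂ k)ᴴ) * W = -(W * (D₂ k - (D₂ k)ᴴ)) := fun k => by
    have := mul_volume_of_sign (A := A) (X := D₂ k - (D₂ k)ᴴ) (fun l => if l = i then -1 else 1)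
      fun l => by
        split_ifs with hl
        · subst hl; rw [hT₂]; simp
        · rw [hT₂' _ _ hl]; simp
    rw [this, Finset.prod_ite_eq' Finset.univ i, if_pos (Finset.mem_univ i),
      neg_smul, one_smul]
  have hT₁F : ∀ k, (D₁ k - (D₁ k)ᴴ) * F = -(F * (D₁ k - (D₁ k)ᴴ)) := fun k => by
    rw [hF, ← mul_assoc, hT₁W, mul_assoc, hT₁, mul_neg, mul_assoc]
  have hT₂F : ∀ k, (D₂ k - (D₂ k)ᴴ) * F = F * (D₂ k - (D₂ k)ᴴ) := fun k => by
    rw [hF, ← mul_assoc, hT₂W, neg_mul, mul_assoc, hT₂, mul_neg, neg_neg, mul_assoc]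
  have hK₁ : ∀ k, (D₁ k - (D₁ k)ᴴ) * W ∈ 𝒜 := fun k => mem𝒜 _ fun l => by
    rw [mul_assoc, hWA, mul_neg, ← mul_assoc, hT₁, neg_mul, neg_neg, mul_assoc]
  have hK₂ : ∀ k, (D₂ k - (D₂ k)ᴴ) * F ∈ 𝒜 := fun k => mem𝒜 _ fun l => by
    by_cases hl : l = i
    · subst hl; rw [mul_assoc, hFi, mul_neg, ← mul_assoc, hT₂, neg_mul, neg_neg, mul_assoc]
    · rw [mul_assoc, hFl l hl, ← mul_assoc, hT₂' _ _ hl, mul_assoc]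
  have hFstar : Fᴴ = F ∨ Fᴴ = -F := by
    have e : Fᴴ = -(A i * Wᴴ) := by rw [hF, Matrix.conjTranspose_mul, hA.star, neg_mul]
    have e' : A i * W = -F := by rw [hF, hWA, neg_neg]
    rcases hA.list_prod_conjTranspose (Finset.univ : Finset κ).toList with h | h
    · left; rw [e, hW, volume, h]; change -(A i * W) = F; rw [e', neg_neg]
    · right; rw [e, hW, volume, h, mul_neg]; change - -(A i * W) = -F; rw [e', neg_neg]
  have hTT : ∀ k l, (D₁ k - (D₁ k)ᴴ) * (D₂ l - (D₂ l)ᴴ) =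
      (D₂ l - (D₂ l)ᴴ) * (D₁ k - (D₁ k)ᴴ) := fun k l => by
    simp only [sub_mul, mul_sub, hcomm, hc₁, hc₂, hc₃]; abel
  refine false_of_commuting_subspaces (𝒜 := 𝒜)
    (P₁ := Submodule.span ℂ (Set.range fun k => D₁ k + (D₁ k)ᴴ))
    (Q₁ := Submodule.span ℂ (Set.range fun k => (D₁ k - (D₁ k)ᴴ) * W))
    (P₂ := Submodule.span ℂ (Set.range fun k => D₂ k + (D₂ k)ᴴ))
    (Q₂ := Submodule.span ℂ (Set.range fun k => (D₂ k - (D₂ k)ᴴ) * F))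
    (mem𝒜 _ fun l => by simp) ?_ ?_ ?_ ?_ ?_ ?_ ?_ ?_ ?_ ?_ ?_ ?_ ?_ ?_ ?_
  · exact fun x hx y hy => mem𝒜 _ fun l => by
      rw [mul_assoc, mem𝒜' y hy, ← mul_assoc, mem𝒜' x hx, mul_assoc]
  · intro x hx
    refine mem𝒜 _ fun l => ?_
    have := congrArg Matrix.conjTranspose (mem𝒜' x hx l)
    rw [Matrix.conjTranspose_mul, Matrix.conjTranspose_mul, hA.star] at this
    simpa using this.symm
  · have := hA.two_pow_mul_finrank_commutant_le hκ Finset.univ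
    rw [hcard, Finset.card_univ] at this
    exact Nat.le_of_mul_le_mul_left this (by positivity)
  · exact fun x hx hxc => hA.mem_span_one_of_mem_center hκ hx hxc
  · rw [Submodule.span_le]; rintro _ ⟨k, rfl⟩; exact hH₁ k
  · rw [Submodule.span_le]; rintro _ ⟨k, rfl⟩; exact hK₁ k
  · rw [Submodule.span_le]; rintro _ ⟨k, rfl⟩; exact hH₂ k
  · rw [Submodule.span_le]; rintro _ ⟨k, rfl⟩; exact hK₂ k
  · simpa only [one_smul] using span_mul_eq_smul_mul 1 (by
      rintro _ ⟨k, rfl⟩ _ ⟨l, rfl⟩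
      beta_reduce
      simp only [add_mul, mul_add, hcomm, hc₁, hc₂, hc₃, one_smul]; abel)
  · simpa only [one_smul] using span_mul_eq_smul_mul 1 (by
      rintro _ ⟨k, rfl⟩ _ ⟨l, rfl⟩
      beta_reduce
      have e : (D₁ k + (D₁ k)ᴴ) * (D₂ l - (D₂ l)ᴴ) = (D₂ l - (D₂ l)ᴴ) * (D₁ k + (D₁ k)ᴴ) := by
        simp only [add_mul, mul_add, sub_mul, mul_sub, hcomm, hc₁, hc₂, hc₃]; abel
      rw [one_smul, ← mul_assoc, e, mul_assoc, h𝒜F _ (hH₁ k)]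
      exact (mul_assoc _ _ _).symm)
  · simpa only [one_smul] using span_mul_eq_smul_mul 1 (by
      rintro _ ⟨k, rfl⟩ _ ⟨l, rfl⟩
      beta_reduce
      have e : (D₁ k - (D₁ k)ᴴ) * (D₂ l + (D₂ l)ᴴ) = (D₂ l + (D₂ l)ᴴ) * (D₁ k - (D₁ k)ᴴ) := by
        simp only [add_mul, mul_add, sub_mul, mul_sub, hcomm, hc₁, hc₂, hc₃]; abel
      rw [one_smul, mul_assoc, ← h𝒜W _ (hH₂ l), ← mul_assoc, e, mul_assoc])
  · simpa only [neg_smul, one_smul] using span_mul_eq_smul_mul (-1) (by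
      rintro _ ⟨k, rfl⟩ _ ⟨l, rfl⟩
      beta_reduce
      set X := D₁ k - (D₁ k)ᴴ
      set Y := D₂ l - (D₂ l)ᴴ
      rw [neg_smul, one_smul]
      have hXY : X * Y = Y * X := hTT k l
      have hWY : W * Y = -(Y * W) := by rw [hT₂W l, neg_neg]
      have hXF : X * F = -(F * X) := hT₁F k
      -- Three sign changes, from `W` past `Y`, `W` past `F` and `X` past `F`, leave an odd sign.
      calc X * W * (Y * F) = X * (W * Y) * F := by simp only [mul_assoc]
        _ = -(X * Y * (W * F)) := by rw [hWY]; simp only [mul_assoc, mul_neg, neg_mul]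
        _ = Y * X * (F * W) := by rw [hXY, hFW, mul_neg]
        _ = Y * (X * F) * W := by simp only [mul_assoc]
        _ = -(Y * F * (X * W)) := by rw [hXF]; simp only [mul_assoc, mul_neg, neg_mul])
  · refine span_conjTranspose_mem ?_
    rintro _ ⟨k, rfl⟩
    have hmem : (D₂ k - (D₂ k)ᴴ) * F ∈
        Submodule.span ℂ (Set.range fun k => (D₂ k - (D₂ k)ᴴ) * F) :=
      Submodule.subset_span ⟨k, rfl⟩
    have e : ((D₂ k - (D₂ k)ᴴ) * F)ᴴ = -(Fᴴ * (D₂ k - (D₂ k)ᴴ)) := by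
      rw [Matrix.conjTranspose_mul, Matrix.conjTranspose_sub, Matrix.conjTranspose_conjTranspose,
        ← mul_neg, neg_sub]
    simp only [e]
    rcases hFstar with h | h <;> rw [h]
    · rw [← hT₂F]; exact neg_mem hmem
    · rw [neg_mul, neg_neg, ← hT₂F]; exact hmem
  · simpa using card_le_finrank_span_add hWu
      (linearIndependent_complex_of_conjTranspose_mul (hA.isUnit i) (fun k => h₁ k i) hli₁)
  · simpa using card_le_finrank_span_add hFu
      (linearIndependent_complex_of_conjTranspose_mul (hA.isUnit i) h₂ hli₂)

end IsCliffordFamily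

/-- There are no `2 * b + 3` pairwise orthogonal families of four linearly independent unitary
matrices of size `2 ^ (b + 2)`. -/
theorem false_of_orthogonal_families {b : ℕ} (hn : Fintype.card n = 2 ^ (b + 2))
    {w : Option (Fin (2 * b + 2)) → Fin 4 → Matrix n n ℂ}
    (hw : ∀ i k, w i k ∈ Matrix.unitaryGroup n ℂ) (hli : ∀ i, LinearIndependent ℝ (w i))
    (horth : ∀ i j, i ≠ j → ∀ k l, (w i k)ᴴ * w j l + (w j l)ᴴ * w i k = 0) : False := by
  have hu : ∀ i k, (w i k)ᴴ * w i k = 1 := fun i k => (Matrix.mem_unitaryGroup_iff').1 (hw i k)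
  have hu' : ∀ i k, w i k * (w i k)ᴴ = 1 := fun i k => (Matrix.mem_unitaryGroup_iff).1 (hw i k)
  set V := w none 0 with hV
  have hVu := hu' none 0
  rw [← hV] at hVu
  let v : Option (Fin (2 * b + 2)) → Fin 4 → Matrix n n ℂ := fun i k => Vᴴ * w i k
  have hvu : ∀ i k, (v i k)ᴴ * v i k = 1 := fun i k => by
    simp only [v, Matrix.conjTranspose_mul, Matrix.conjTranspose_conjTranspose]
    rw [mul_assoc, ← mul_assoc V, hVu, one_mul, hu]
  have hvu' : ∀ i k, v i k * (v i k)ᴴ = 1 := fun i k => mul_eq_one_comm.1 (hvu i k)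
  have hvo : ∀ i j, i ≠ j → ∀ k l, (v i k)ᴴ * v j l = -((v j l)ᴴ * v i k) := fun i j hij k l => by
    have := horth i j hij k l
    simp only [v, Matrix.conjTranspose_mul, Matrix.conjTranspose_conjTranspose]
    rw [mul_assoc, ← mul_assoc V, hVu, one_mul, mul_assoc, ← mul_assoc V, hVu, one_mul]
    exact eq_neg_of_add_eq_zero_left this
  have hv1 : v none 0 = 1 := hu none 0
  have hvs : ∀ i k, (v (some i) k)ᴴ = -v (some i) k := fun i k => by
    simpa [hv1] using hvo (some i) none (by simp) k 0
  have hmulli : ∀ (Y : Matrix n n ℂ), IsUnit Y → ∀ f : Fin 4 → Matrix n n ℂ,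
      LinearIndependent ℝ f → LinearIndependent ℝ fun k => Y * f k := fun Y hY f hf =>
    hf.map' (LinearMap.mulLeft ℝ Y)
      (LinearMap.ker_eq_bot.2 fun x y h => hY.mul_left_cancel h)
  have hVunit : IsUnit Vᴴ := .of_mul_eq_one V (hu none 0)
  have hvli : ∀ i, LinearIndependent ℝ (v i) := fun i => hmulli _ hVunit _ (hli i)
  have hA : IsCliffordFamily fun i => v (some i) 0 :=
    { sq := fun i => by
        have := hvu (some i) 0
        rw [hvs, neg_mul] at this
        exact neg_eq_iff_eq_neg.1 this
      star := fun i => hvs i 0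
      anticomm := fun i j hij => by
        have := hvo (some i) (some j) (by simpa using hij) 0 0
        rw [hvs, hvs] at this
        exact neg_eq_iff_eq_neg.1 (by simpa using this) }
  have hac : ∀ i j, i ≠ j → ∀ k l,
      v (some i) k * v (some j) l = -(v (some j) l * v (some i) k) := fun i j hij k l => by
    have := hvo (some i) (some j) (by simpa using hij) k l
    rw [hvs, hvs] at this
    exact neg_eq_iff_eq_neg.1 (by simpa using this)
  have h1 : ∀ k i l, (v none k)ᴴ * v (some i) l = v (some i) l * v none k := fun k i l => by
    have := hvo none (some i) (by simp) k l
    rw [hvs] at this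
    simpa using this
  clear_value v
  set Z := v (some 0) 0 with hZ
  have hZu : IsUnit Z := hA.isUnit 0
  have hZstar : Zᴴ = -Z := hvs 0 0
  have hZsq : Z * Z = -1 := hA.sq 0
  have hY : ∀ k, Z * (Zᴴ * v (some 0) k) = v (some 0) k := fun k => by
    rw [← mul_assoc, hZ, hvu', one_mul]
  -- Group `some 0` is divided by its representative `Z`, so that its matrices commute with the
  -- other Clifford members and with group `none`.
  refine hA.not_linearIndependent_pair (i := 0) (j := 1) (D₁ := v none)
    (D₂ := fun k => Zᴴ * v (some 0) k) ?_ ?_ ?_ (hvli none)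
    (hmulli _ (hZstar ▸ hZu.neg) _ (hvli _)) ?_ ?_ ?_ ?_
  · simp [parity_simps]
  · rw [hn, Fintype.card_fin]; ring
  · simp
  · exact fun k i => h1 k i 0
  · intro k
    change (Zᴴ * v (some 0) k)ᴴ * Z = Z * (Zᴴ * v (some 0) k)
    rw [hY, Matrix.conjTranspose_mul, Matrix.conjTranspose_conjTranspose, hvs, mul_assoc, hZsq]
    simp
  · intro k l hl
    have e := hac 0 l hl.symm k 0
    have e' := hac 0 l hl.symm 0 0
    rw [← hZ] at e'
    change Zᴴ * v (some 0) k * v (some l) 0 = v (some l) 0 * (Zᴴ * v (some 0) k)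
    rw [hZstar, mul_assoc, e, neg_mul_neg, neg_mul, mul_neg, ← mul_assoc, e']
    simp [mul_assoc]
  · intro k l
    refine hZu.mul_left_cancel ?_
    rw [← mul_assoc, ← h1 k 0 0, mul_assoc, hY, h1, ← mul_assoc, hY]

end Pair

/-! ### The optimal design: Hurwitz-Radon families by doubling -/

/-- A family of pairwise orthogonal unitary matrices, in the sense of Hurwitz and Radon, with
orthogonality of both the matrices and their adjoints. -/
structure IsHurwitzRadon {n κ : Type*} [Fintype n] [DecidableEq n]
    (U : κ → Matrix n n ℂ) : Prop where
  left_unitary : ∀ i, (U i)ᴴ * U i = 1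
  right_unitary : ∀ i, U i * (U i)ᴴ = 1
  left_orth : ∀ i j, i ≠ j → (U i)ᴴ * U j + (U j)ᴴ * U i = 0
  right_orth : ∀ i j, i ≠ j → U i * (U j)ᴴ + U j * (U i)ᴴ = 0

namespace IsHurwitzRadon

variable {n κ : Type*} [Fintype n] [DecidableEq n]

/-- Doubling of a Hurwitz-Radon family. -/
noncomputable def double (U : κ → Matrix n n ℂ) : Option (Option κ) → Matrix (n ⊕ n) (n ⊕ n) ℂ
  | none => 1
  | some none => Matrix.fromBlocks (Complex.I • 1) 0 0 (-(Complex.I • 1))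
  | some (some i) => Matrix.fromBlocks 0 (U i) (-(U i)ᴴ) 0

/-- Products of the off-diagonal members carry `U i * (U j)ᴴ` in one block and `(U i)ᴴ * U j` in the
other, so both orthogonality conditions are needed in the induction. -/
theorem isHurwitzRadon_double {U : κ → Matrix n n ℂ} (hU : IsHurwitzRadon U) :
    IsHurwitzRadon (double U) := by
  constructor
  · rintro (_ | _ | i)
    · simp [double]
    · simp [double, Matrix.fromBlocks_conjTranspose, Matrix.fromBlocks_multiply, smul_smul,
        Matrix.conjTranspose_smul]
    · simp [double, Matrix.fromBlocks_conjTranspose, Matrix.fromBlocks_multiply,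
        hU.left_unitary, hU.right_unitary]
  · rintro (_ | _ | i)
    · simp [double]
    · simp [double, Matrix.fromBlocks_conjTranspose, Matrix.fromBlocks_multiply, smul_smul,
        Matrix.conjTranspose_smul]
    · simp [double, Matrix.fromBlocks_conjTranspose, Matrix.fromBlocks_multiply,
        hU.left_unitary, hU.right_unitary]
  · rintro (_ | _ | i) (_ | _ | j) hij
    all_goals first | exact absurd rfl hij | skip
    all_goals simp [double, Matrix.fromBlocks_conjTranspose, Matrix.fromBlocks_multiply,
      Matrix.fromBlocks_add, Matrix.conjTranspose_smul]
    rw [hU.right_orth i j (by simpa using hij), hU.left_orth i j (by simpa using hij),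
      Matrix.fromBlocks_zero]
  · rintro (_ | _ | i) (_ | _ | j) hij
    all_goals first | exact absurd rfl hij | skip
    all_goals simp [double, Matrix.fromBlocks_conjTranspose, Matrix.fromBlocks_multiply,
      Matrix.fromBlocks_add, Matrix.conjTranspose_smul]
    rw [hU.right_orth i j (by simpa using hij), hU.left_orth i j (by simpa using hij),
      Matrix.fromBlocks_zero]

theorem exists_family (b : ℕ) : ∃ (n κ : Type) (_ : Fintype n) (_ : DecidableEq n) (_ : Fintype κ)
    (_ : DecidableEq κ) (U : κ → Matrix n n ℂ),
    Fintype.card n = 2 ^ b ∧ Fintype.card κ = 2 * b + 2 ∧ IsHurwitzRadon U := by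
  induction b with
  | zero =>
    refine ⟨Unit, Bool, inferInstance, inferInstance, inferInstance, inferInstance,
      fun s => if s then Complex.I • 1 else 1, by simp, by simp, ?_⟩
    constructor
    · rintro (_ | _) <;> simp [Matrix.conjTranspose_smul, smul_smul]
    · rintro (_ | _) <;> simp [Matrix.conjTranspose_smul, smul_smul]
    · rintro (_ | _) (_ | _) h <;> first | exact absurd rfl h | simp [Matrix.conjTranspose_smul]
    · rintro (_ | _) (_ | _) h <;> first | exact absurd rfl h | simp [Matrix.conjTranspose_smul]
  | succ b ih =>
    obtain ⟨n, κ, _, _, _, _, U, hn, hκ, hU⟩ := ih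
    refine ⟨n ⊕ n, Option (Option κ), inferInstance, inferInstance, inferInstance, inferInstance,
      double U, ?_, ?_, isHurwitzRadon_double hU⟩
    · rw [Fintype.card_sum, hn]; ring
    · rw [Fintype.card_option, Fintype.card_option, hκ]; ring

/-- Multiplying the combination by its adjoint cancels the cross terms and leaves the sum of the `c
i ^ 2` times the identity. -/
theorem eq_zero_of_sum_smul [Fintype κ] [DecidableEq κ] [Nonempty n] {U : κ → Matrix n n ℂ}
    (hU : IsHurwitzRadon U) {c : κ → ℝ} (hc : ∑ i, c i • U i = 0) : c = 0 := by
  have hsum : (∑ i, ∑ j, (c i * c j) • ((U i)ᴴ * U j)) = 0 := by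
    have : (∑ i, c i • U i)ᴴ * (∑ j, c j • U j) = 0 := by rw [hc, mul_zero]
    rw [← this, Matrix.conjTranspose_sum, Finset.sum_mul_sum]
    refine Finset.sum_congr rfl fun i _ => Finset.sum_congr rfl fun j _ => ?_
    rw [Matrix.conjTranspose_smul, star_trivial, smul_mul_smul_comm]
  have hpair : ∀ i j, (c i * c j) • ((U i)ᴴ * U j) + (c j * c i) • ((U j)ᴴ * U i) =
      if j = i then (2 * (c i * c i)) • (1 : Matrix n n ℂ) else 0 := by
    intro i j
    split_ifs with h
    · subst h; rw [hU.left_unitary, two_mul, add_smul]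
    · rw [mul_comm (c j), ← smul_add, hU.left_orth i j (Ne.symm h), smul_zero]
  have hsq : (∑ i, 2 * (c i * c i)) • (1 : Matrix n n ℂ) = 0 := by
    have h2 : (∑ i, ∑ j, ((c i * c j) • ((U i)ᴴ * U j) + (c j * c i) • ((U j)ᴴ * U i))) = 0 := by
      simp only [Finset.sum_add_distrib]
      rw [hsum, Finset.sum_comm, hsum, add_zero]
    rw [← h2, Finset.sum_smul]
    refine Finset.sum_congr rfl fun i _ => ?_
    simp only [hpair]
    simp
  rw [smul_eq_zero, or_iff_left one_ne_zero,
    Finset.sum_eq_zero_iff_of_nonneg fun i _ => mul_nonneg zero_le_two (mul_self_nonneg _)] at hsq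
  funext i
  simpa using hsq i (Finset.mem_univ i)

end IsHurwitzRadon

/-! ### From one unitary to a group of four by block signs -/

/-- A sign vector of length four with `-1` exactly in position `s`. -/
def signVector (s r : Fin 4) : ℂ := if r = s then -1 else 1

theorem star_signVector (s r : Fin 4) : star (signVector s r) = signVector s r := by
  unfold signVector; split_ifs <;> simp

theorem signVector_mul_self (s r : Fin 4) : signVector s r * signVector s r = 1 := by
  unfold signVector; split_ifs <;> simp

section SignExtend

variable {n κ : Type*} [Fintype n] [DecidableEq n]

/-- The block diagonal matrix with blocks `± U p.1`, the signs given by `signVector p.2`. -/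
noncomputable def signExtend (U : κ → Matrix n n ℂ) (p : κ × Fin 4) :
    Matrix (n × Fin 4) (n × Fin 4) ℂ :=
  Matrix.blockDiagonal fun r => signVector p.2 r • U p.1

theorem signExtend_conjTranspose_mul (U : κ → Matrix n n ℂ) (p q : κ × Fin 4) :
    (signExtend U p)ᴴ * signExtend U q =
      Matrix.blockDiagonal fun r =>
        (signVector p.2 r * signVector q.2 r) • ((U p.1)ᴴ * U q.1) := by
  rw [signExtend, signExtend, Matrix.blockDiagonal_conjTranspose, ← Matrix.blockDiagonal_mul]
  congr 1
  funext r
  rw [Matrix.conjTranspose_smul, star_signVector, smul_mul_smul_comm]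

theorem signExtend_unitary {U : κ → Matrix n n ℂ} (hU : IsHurwitzRadon U) (p : κ × Fin 4) :
    (signExtend U p)ᴴ * signExtend U p = 1 := by
  rw [signExtend_conjTranspose_mul]
  simp only [signVector_mul_self, hU.left_unitary, one_smul]
  exact Matrix.blockDiagonal_one

theorem signExtend_orth {U : κ → Matrix n n ℂ} (hU : IsHurwitzRadon U) {p q : κ × Fin 4}
    (h : p.1 ≠ q.1) :
    (signExtend U p)ᴴ * signExtend U q + (signExtend U q)ᴴ * signExtend U p = 0 := by
  rw [signExtend_conjTranspose_mul, signExtend_conjTranspose_mul, ← Matrix.blockDiagonal_add]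
  rw [← Matrix.blockDiagonal_zero]
  congr 1
  funext r
  rw [Pi.add_apply, mul_comm (signVector q.2 r), ← smul_add, hU.left_orth _ _ h, smul_zero]
  rfl

theorem linearIndependent_signExtend [Fintype κ] [DecidableEq κ] [Nonempty n]
    {U : κ → Matrix n n ℂ} (hU : IsHurwitzRadon U) : LinearIndependent ℝ (signExtend U) := by
  rw [Fintype.linearIndependent_iff]
  intro c hc
  let σ : Fin 4 → Fin 4 → ℝ := fun s r => if r = s then -1 else 1
  have hblock : ∀ r, ∑ i, (∑ s, c (i, s) * σ s r) • U i = 0 := by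
    intro r
    ext x y
    have := congrFun (congrFun hc (x, r)) (y, r)
    rw [Fintype.sum_prod_type] at this
    simp only [Matrix.sum_apply, Matrix.smul_apply, Matrix.zero_apply, signExtend,
      Matrix.blockDiagonal_apply_eq] at this ⊢
    rw [← this]
    refine Finset.sum_congr rfl fun i _ => ?_
    rw [Finset.sum_smul]
    refine Finset.sum_congr rfl fun s _ => ?_
    simp only [σ, signVector]
    split_ifs <;> simp
  have hcs : ∀ r i, ∑ s, c (i, s) * σ s r = 0 := fun r i =>
    congrFun (hU.eq_zero_of_sum_smul (hblock r)) i
  rintro ⟨i, s⟩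
  have e0 := hcs 0 i
  have e1 := hcs 1 i
  have e2 := hcs 2 i
  have e3 := hcs 3 i
  simp [Fin.sum_univ_four, σ] at e0 e1 e2 e3
  -- The sign matrix is the all-ones matrix minus twice the identity, with eigenvalues `2` and `-2`
  -- in size four, hence invertible.
  fin_cases s <;> simp <;> linarith

end SignExtend

/-! ### Translation to designs and rates -/

theorem LSTDesign.exists_design (b : ℕ) : ∃ D : LSTDesign (2 ^ (b + 2)) ((2 * b + 2) * 4),
    D.IsUnitaryWeight ∧ D.IsRealSymbolDecodable 4 := by
  obtain ⟨n, κ, _, _, _, _, U, hn, hκ, hU⟩ := IsHurwitzRadon.exists_family b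
  have : Nonempty n := Fintype.card_pos_iff.1 (by rw [hn]; positivity)
  let e : Fin (2 ^ (b + 2)) ≃ n × Fin 4 := Fintype.equivOfCardEq (by
    rw [Fintype.card_prod, hn]; simp [pow_succ, mul_assoc])
  let f : κ ≃ Fin (2 * b + 2) := Fintype.equivOfCardEq (by simp [hκ])
  let p : Fin ((2 * b + 2) * 4) ≃ κ × Fin 4 := Fintype.equivOfCardEq (by
    rw [Fintype.card_prod, hκ]; simp)
  let φ := Matrix.reindexLinearEquiv ℝ ℂ e.symm e.symm
  refine ⟨⟨fun k => (signExtend U (p k)).submatrix e e, ?_⟩, ?_, 2 * b + 2, fun k => f (p k).1,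
    ?_, ?_⟩
  · exact ((linearIndependent_signExtend hU).comp p p.injective).map' φ.toLinearMap
      (LinearEquiv.ker φ)
  · intro k
    rw [Matrix.mem_unitaryGroup_iff', Matrix.star_eq_conjTranspose]
    change ((signExtend U (p k)).submatrix e e)ᴴ * (signExtend U (p k)).submatrix e e = 1
    rw [Matrix.conjTranspose_submatrix, Matrix.submatrix_mul_equiv, signExtend_unitary hU,
      Matrix.submatrix_one_equiv]
  · intro i
    rw [← Fintype.card_subtype]
    let ψ : {k // f (p k).1 = i} ≃ Fin 4 :=
      { toFun := fun k => (p k).2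
        invFun := fun s => ⟨p.symm (f.symm i, s), by simp⟩
        left_inv := fun ⟨k, hk⟩ => by
          subst hk; simp
        right_inv := fun s => by simp }
    rw [Fintype.card_congr ψ, Fintype.card_fin]
  · intro k l hkl
    have h : (p k).1 ≠ (p l).1 := fun h => hkl (congrArg f h)
    change ((signExtend U (p k)).submatrix e e)ᴴ * (signExtend U (p l)).submatrix e e +
      ((signExtend U (p l)).submatrix e e)ᴴ * (signExtend U (p k)).submatrix e e = 0
    rw [Matrix.conjTranspose_submatrix, Matrix.conjTranspose_submatrix,
      Matrix.submatrix_mul_equiv, Matrix.submatrix_mul_equiv]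
    exact congrArg (fun M => M.submatrix e e) (signExtend_orth hU h)

theorem LSTDesign.IsGroupDecodable.card_groups_le {b K g : ℕ} {D : LSTDesign (2 ^ (b + 2)) K}
    (hD : D.IsUnitaryWeight) (hg : D.IsGroupDecodable g 4) : g ≤ 2 * b + 2 := by
  obtain ⟨group, hcard, horth⟩ := hg
  by_contra hlt
  push Not at hlt
  -- Any `2 * b + 3` of the groups suffice; the index `none` marks the one that will be normalised
  -- to contain `1`.
  obtain ⟨ι⟩ : Nonempty (Option (Fin (2 * b + 2)) ↪ Fin g) :=
    Function.Embedding.nonempty_of_card_le (by simpa using hlt)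
  have hmem : ∀ i k, group ((Finset.equivFinOfCardEq (hcard i)).symm k) = i := fun i k => by
    exact (Finset.mem_filter.1 ((Finset.equivFinOfCardEq (hcard i)).symm k).2).2
  refine false_of_orthogonal_families (b := b) (n := Fin (2 ^ (b + 2))) (by simp)
    (w := fun i k => D.weight ((Finset.equivFinOfCardEq (hcard (ι i))).symm k))
    (fun _ _ => hD _) (fun i => ?_) fun i j hij k l => horth _ _ ?_
  · exact D.linearIndependent.comp _
      (Subtype.val_injective.comp (Finset.equivFinOfCardEq (hcard (ι i))).symm.injective)
  · rw [hmem, hmem]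
    exact fun h => hij (ι.injective h)

theorem LSTDesign.IsGroupDecodable.card_eq {n K g lam : ℕ} {D : LSTDesign n K}
    (hg : D.IsGroupDecodable g lam) : K = g * lam := by
  obtain ⟨group, hcard, -⟩ := hg
  have := Finset.card_eq_sum_card_fiberwise (f := group) (s := Finset.univ) (t := Finset.univ)
    (fun _ _ => Finset.mem_coe.2 (Finset.mem_univ _))
  simpa [hcard] using this

theorem theorem4 (a : ℕ) (ha : 2 ≤ a) :
    (∀ (K : ℕ) (D : LSTDesign (2 ^ a) K),
      D.IsUnitaryWeight → D.IsRealSymbolDecodable 4 →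
        D.rate ≤ ((a : ℝ) - 1) / 2 ^ (a - 2)) ∧
    (∃ (K : ℕ) (D : LSTDesign (2 ^ a) K),
      D.IsUnitaryWeight ∧ D.IsRealSymbolDecodable 4 ∧
        D.rate = ((a : ℝ) - 1) / 2 ^ (a - 2)) ∧
    ((a : ℝ) - 1) / 2 ^ (a - 2) = 4 * ((a : ℝ) - 1) / 2 ^ a := by
  obtain ⟨b, rfl⟩ := Nat.exists_eq_add_of_le' ha
  have hb : (((b + 2 : ℕ) : ℝ) - 1) = b + 1 := by push_cast; ring
  rw [hb, Nat.add_sub_cancel]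
  refine ⟨fun K D hD ⟨g, hg⟩ => ?_, ?_, by rw [pow_add]; field_simp; ring⟩
  · have hle : (g : ℝ) ≤ 2 * b + 2 := by exact_mod_cast hg.card_groups_le hD
    have hK := hg.card_eq
    rw [LSTDesign.rate, hK]
    push_cast
    rw [div_le_div_iff₀ (by positivity) (by positivity), pow_add]
    have : (0 : ℝ) < 2 ^ b := by positivity
    nlinarith
  · obtain ⟨D, hD, hdec⟩ := LSTDesign.exists_design b
    refine ⟨_, D, hD, hdec, ?_⟩
    rw [LSTDesign.rate]
    push_cast
    rw [pow_add]
    field_simp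
    ring
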